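/- Let $K$ be a field of characteristic zero and $R=K[x_0,x_1,x_2,x_3]$ the coordinate ring of $\mathbb P^3$ over $K$. For an ideal $I\subset R$ and $m\ge 0$ let $I^{(m)}$ be its $m$-th symbolic power, that is, the set of $f\in R$ with $f\in I^mR_{\mathfrak p}$ for all associated primes $\mathfrak p$ of $R/I$, and let $\alpha(I)$ be the least degree of a nonzero form in $I$. For points $p_1,\dots,p_n\in\mathbb P^3(K)$ let $I(p)=\mathfrak m_{p_1}\cap\dots\cap\mathfrak m_{p_n}$, where $\mathfrak m_q$ is the ideal generated by the forms vanishing at $q$ (so $I(p)=R$ if $n=0$). Then for all $n,m\ge 0$ the number $\alpha(I(p)^{(m)})$ takes a constant value $\alpha(n,m)$ for $(p_1,\dots,p_n)$ in some nonempty Zariski open subset of $\mathbb P^3(K)^n$, and the limit $$\gamma(n)=\lim_{m\to\infty}\frac{\alpha(n,m)}{m}$$ exists for every $n\ge 0$. It is the Waldschmidt constant of $n$ generic points: there are countably many nonempty Zariski open subsets of $\mathbb P^3(K)^n$ such that $\lim_{m\to\infty}\alpha(I(p)^{(m)})/m=\gamma(n)$ for every $p$ in their intersection. Moreover: * $\gamma(n)\ge\gamma(k)$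 for all integers $n\ge k\ge 0$; * $\gamma(a\cdot 8^k)\ge 2^k\cdot\gamma(a)$ for all nonnegative integers $a$ and $k$. -/

import Mathlib

open Filter Topology
open scoped LinearAlgebra.Projectivization

noncomputable section

namespace GenericPoints

/-- The coordinate ring `K[x_0, …, x_N]` of the projective space `ℙ^N` over `K`. -/
abbrev CoordRing (K : Type*) [Field K] (N : ℕ) : Type _ := MvPolynomial (Fin (N + 1)) K

/-- The points of `ℙ^N` that are rational over `K`. -/
abbrev ProjPoint (K : Type*) [Field K] (N : ℕ) : Type _ := ℙ K (Fin (N + 1) → K)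

/-- The `m`-th symbolic power of an ideal `I` of a commutative ring `R`: the elements of `R` whose
image in `R_𝔭` lies in `I ^ m R_𝔭`, for every associated prime `𝔭` of `R ⧸ I`. -/
def symbolicPower {R : Type*} [CommRing R] (I : Ideal R) (m : ℕ) : Ideal R :=
  ⨅ 𝔭 : associatedPrimes R (R ⧸ I),
    haveI : (𝔭 : Ideal R).IsPrime := 𝔭.2.isPrime
    ((I ^ m).map (algebraMap R (Localization.AtPrime (𝔭 : Ideal R)))).comap
      (algebraMap R (Localization.AtPrime (𝔭 : Ideal R)))

/-- `α(I)`: the least degree of a nonzero form in `I`. -/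
def alpha {K : Type*} [Field K] {N : ℕ} (I : Ideal (CoordRing K N)) : ℕ :=
  sInf {t : ℕ | ∃ f ∈ I, f.IsHomogeneous t ∧ f ≠ 0}

/-- `c` is the Waldschmidt constant `γ(I)` of the ideal `I`, that is, the limit of
`α(I^(m)) / m` for `m → ∞` exists and equals `c`. -/
def HasWaldschmidtConstant {K : Type*} [Field K] {N : ℕ} (I : Ideal (CoordRing K N)) (c : ℝ) :
    Prop :=
  Tendsto (fun m : ℕ => (alpha (symbolicPower I m) : ℝ) / m) atTop (𝓝 c)

/-- `𝔪_p`: the ideal generated by the forms vanishing at the point `p`. (Whether a form vanishes at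
`p` does not depend on the chosen coordinates `p.rep` of `p`.) -/
def pointIdeal {K : Type*} [Field K] {N : ℕ} (p : ProjPoint K N) : Ideal (CoordRing K N) :=
  Ideal.span {f | (∃ d : ℕ, f.IsHomogeneous d) ∧ MvPolynomial.eval p.rep f = 0}

/-- The ideal `𝔪_{p_1} ∩ ⋯ ∩ 𝔪_{p_n}` of simple points; the unit ideal when there are no points. -/
def pointsIdeal {K : Type*} [Field K] {N n : ℕ} (p : Fin n → ProjPoint K N) :
    Ideal (CoordRing K N) :=
  ⨅ i, pointIdeal (p i)

/-- The `n`-tuple `p` of points has homogeneous coordinates at which the polynomial `F` in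
`n * (N + 1)` variables does not vanish. For `F ≠ 0` over an infinite field, this defines a nonempty
Zariski open subset of `(ℙ^N)^n` (some multihomogeneous component of `F` does not vanish at `p`),
and these subsets form a neighbourhood basis of the generic point. -/
def AvoidsZeros {K : Type*} [Field K] {N n : ℕ} (F : MvPolynomial (Fin n × Fin (N + 1)) K)
    (p : Fin n → ProjPoint K N) : Prop :=
  ∃ (v : Fin n → Fin (N + 1) → K) (hv : ∀ i, v i ≠ 0),
    (∀ i, p i = Projectivization.mk K (v i) (hv i)) ∧
      MvPolynomial.eval (fun ij => v ij.1 ij.2) F ≠ 0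

/-- `P` holds for `n` points in general position in `ℙ^N`: it holds on a nonempty Zariski open
subset of `(ℙ^N)^n`. -/
def ForGeneralPoints (K : Type*) [Field K] (N n : ℕ) (P : (Fin n → ProjPoint K N) → Prop) : Prop :=
  ∃ F : MvPolynomial (Fin n × Fin (N + 1)) K, F ≠ 0 ∧ ∀ p, AvoidsZeros F p → P p

/-- `P` holds for `n` points in very general position in `ℙ^N`: it holds on the intersection of
countably many nonempty Zariski open subsets of `(ℙ^N)^n`. -/
def ForVeryGeneralPoints (K : Type*) [Field K] (N n : ℕ) (P : (Fin n → ProjPoint K N) → Prop) :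
    Prop :=
  ∃ F : ℕ → MvPolynomial (Fin n × Fin (N + 1)) K, (∀ j, F j ≠ 0) ∧
    ∀ p, (∀ j, AvoidsZeros (F j) p) → P p

/-- `α(I^(m))` for the ideal `I` of `n` points in general position in `ℙ^N`: the value which
`α(I^(m))` takes on a nonempty Zariski open set of `n`-tuples of points (over an infinite field there
is at most one such value). -/
def genericAlpha (K : Type*) [Field K] (N n m : ℕ) : ℕ :=
  sInf {a : ℕ | ForGeneralPoints K N n fun p => alpha (symbolicPower (pointsIdeal p) m) = a}

/-- `γ(N, n)`: the limit of `α(I^(m)) / m` for `m → ∞`, where `I` is the ideal of `n` points in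
general position in `ℙ^N`. -/
def gamma (K : Type*) [Field K] (N n : ℕ) : ℝ :=
  limUnder atTop fun m : ℕ => (genericAlpha K N n m : ℝ) / m

end GenericPoints

end

/-! A form lies in `I(p)^(m)` exactly when its Taylor expansions at representatives of the points
have no terms of degree below `m`. For fixed degree this is a linear system with coefficients
polynomial in the points. Having only the zero solution is therefore an open condition, so the
general value of `α` is the largest one, `maxLeastDegree`, which bounds every configuration, however
special. Products of forms make it subadditive in `m`, so Fekete's lemma gives the limit; dropping
points gives monotonicity.

For the factor 8, let `f` have degree `d` and order `m` at the `8a` sign changes of `a` points `z_i`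
(`maxLeastDegree_eight_mul_le`). The product of the 8 sign changes of `f` is invariant, hence equals
`g(x_0^2, …, x_3^2)` with `deg g = 4d`, and has order `8m` at each `z_i`. Squaring is étale off the
coordinate hyperplanes, so `g` has order `8m` at the points `z_i^2`, which can be taken general.
Thus `α(a, 8m) ≤ 4 α(8a, m)`; dividing by `4m` gives `2γ(a) ≤ γ(8a)`. -/

namespace GenericPoints

open MvPolynomial

/-! ### Vanishing order at points of affine space -/

section VanishingOrder

variable {K σ : Type*} [Field K]

/-- The substitution `f(X) ↦ f(X + v)`. -/
noncomputable def translate (v : σ → K) : MvPolynomial σ K →ₐ[K] MvPolynomial σ K :=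
  aeval fun j => X j + C (v j)

/-- The polynomial `f` vanishes to order at least `m` at the point `v` of affine space. -/
def VanishesToOrder (f : MvPolynomial σ K) (v : σ → K) (m : ℕ) : Prop :=
  translate v f ∈ idealOfVars σ K ^ m

/-- The substitution `f(X) ↦ f(c X)`, with componentwise multiplication. -/
noncomputable def rescale (c : σ → K) : MvPolynomial σ K →ₐ[K] MvPolynomial σ K :=
  aeval fun j => C (c j) * X j

theorem VanishesToOrder.mul {f g : MvPolynomial σ K} {v : σ → K} {a b : ℕ}
    (hf : VanishesToOrder f v a) (hg : VanishesToOrder g v b) :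
    VanishesToOrder (f * g) v (a + b) := by
  unfold VanishesToOrder at *
  rw [map_mul, pow_add]
  exact Ideal.mul_mem_mul hf hg

theorem VanishesToOrder.prod {ι : Type*} (s : Finset ι) {f : ι → MvPolynomial σ K} {v : σ → K}
    {m : ℕ} (hf : ∀ i ∈ s, VanishesToOrder (f i) v m) :
    VanishesToOrder (∏ i ∈ s, f i) v (s.card * m) := by
  unfold VanishesToOrder at *
  rw [map_prod, mul_comm, pow_mul, ← Finset.prod_const]
  exact Ideal.prod_mem_prod hf

theorem VanishesToOrder.pow {f : MvPolynomial σ K} {v : σ → K} {a : ℕ}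
    (hf : VanishesToOrder f v a) (m : ℕ) : VanishesToOrder (f ^ m) v (a * m) := by
  unfold VanishesToOrder at *
  rw [map_pow, pow_mul]
  exact Ideal.pow_mem_pow hf m

theorem constantCoeff_translate (v : σ → K) (f : MvPolynomial σ K) :
    constantCoeff (translate v f) = eval v f := by
  have h : (constantCoeff.comp (translate v).toRingHom : MvPolynomial σ K →+* K) = eval v := by
    ext j <;> simp [translate]
  exact congrArg (fun φ : MvPolynomial σ K →+* K => φ f) h

theorem translate_mem_idealOfVars {v : σ → K} {f : MvPolynomial σ K} :
    translate v f ∈ idealOfVars σ K ↔ eval v f = 0 := by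
  rw [← constantCoeff_translate, ← pow_one (idealOfVars σ K), mem_pow_idealOfVars_iff']
  constructor
  · intro h
    exact h 0 (by simp)
  · intro h x hx
    have : x = 0 := (Finsupp.degree_eq_zero_iff x).mp (by simpa using hx)
    subst this
    exact h

theorem rescale_mem_pow (c : σ → K) {m : ℕ} {f : MvPolynomial σ K}
    (hf : f ∈ idealOfVars σ K ^ m) : rescale c f ∈ idealOfVars σ K ^ m := by
  have h : (idealOfVars σ K).map (rescale c) ≤ idealOfVars σ K := by
    rw [Ideal.map_span, Ideal.span_le]
    rintro _ ⟨_, ⟨j, rfl⟩, rfl⟩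
    simp only [rescale, aeval_X]
    exact Ideal.mul_mem_left _ _ (Ideal.subset_span ⟨j, rfl⟩)
  have := Ideal.mem_map_of_mem (rescale c) hf
  rw [Ideal.map_pow] at this
  exact Ideal.pow_right_mono h m this

theorem VanishesToOrder.rescale {f : MvPolynomial σ K} {c v : σ → K} {m : ℕ}
    (hf : VanishesToOrder f (c * v) m) : VanishesToOrder (rescale c f) v m := by
  have h : (translate v).comp (GenericPoints.rescale c) =
      (GenericPoints.rescale c).comp (translate (c * v)) := by
    ext j
    simp [translate, GenericPoints.rescale, mul_add]
  have h2 := congrArg (fun φ : MvPolynomial σ K →ₐ[K] MvPolynomial σ K => φ f) h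
  simp only [AlgHom.comp_apply] at h2
  unfold VanishesToOrder at *
  rw [h2]
  exact rescale_mem_pow c hf

theorem rescale_monomial (c : σ → K) (b : σ →₀ ℕ) (r : K) :
    rescale c (monomial b r) = monomial b ((b.prod fun j n => c j ^ n) * r) := by
  rw [rescale, aeval_monomial, monomial_eq (s := b) (a := _ * r)]
  simp only [mul_pow, algebraMap_eq, map_mul, Finsupp.prod, map_prod, map_pow,
    Finset.prod_mul_distrib]
  ring

theorem coeff_rescale (c : σ → K) (b : σ →₀ ℕ) (f : MvPolynomial σ K) :
    coeff b (rescale c f) = (b.prod fun j n => c j ^ n) * coeff b f := by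
  classical
  induction f using MvPolynomial.induction_on' with
  | monomial u r =>
    rw [rescale_monomial, coeff_monomial, coeff_monomial]
    split_ifs with h
    · rw [h]
    · simp
  | add p q hp hq => rw [map_add, coeff_add, coeff_add, hp, hq, mul_add]

theorem isHomogeneous_rescale (c : σ → K) {f : MvPolynomial σ K} {d : ℕ} (hf : f.IsHomogeneous d) :
    (rescale c f).IsHomogeneous d := by
  intro b hb
  rw [coeff_rescale] at hb
  exact hf (right_ne_zero_of_mul hb)

theorem rescale_injective {c : σ → K} (hc : ∀ j, c j ≠ 0) : Function.Injective (rescale c) := by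
  intro f g h
  ext b
  have := congrArg (coeff b) h
  rw [coeff_rescale, coeff_rescale] at this
  exact mul_left_cancel₀ (Finset.prod_ne_zero_iff.mpr fun j _ => pow_ne_zero _ (hc j)) this

theorem rescale_const (c : K) {f : MvPolynomial σ K} {d : ℕ} (hf : f.IsHomogeneous d) :
    rescale (fun _ => c) f = C (c ^ d) * f := by
  ext b
  rw [coeff_rescale, coeff_C_mul]
  by_cases hb : coeff b f = 0
  · simp [hb]
  · have : b.degree = d := by
      by_contra h
      exact hb (hf.coeff_eq_zero h)
    rw [Finsupp.prod, Finset.prod_pow_eq_pow_sum, ← Finsupp.degree_apply, this]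

/-- Scaling all variables by `c` only multiplies a form by `c ^ d`, so its order does not depend on
the representative of a projective point. -/
theorem VanishesToOrder.of_smul {f : MvPolynomial σ K} {d : ℕ} (hf : f.IsHomogeneous d) {c : K}
    (hc : c ≠ 0) {v : σ → K} {m : ℕ} (h : VanishesToOrder f (c • v) m) :
    VanishesToOrder f v m := by
  have h1 : VanishesToOrder (GenericPoints.rescale (fun _ => c) f) v m := VanishesToOrder.rescale h
  rw [rescale_const c hf] at h1
  unfold VanishesToOrder at *
  rw [map_mul] at h1
  have h2 := Ideal.mul_mem_left _ (C (c ^ d)⁻¹) h1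
  have h3 : translate v (C (c ^ d)) = C (c ^ d) := by simp [translate]
  rwa [h3, ← mul_assoc, ← C_mul, inv_mul_cancel₀ (pow_ne_zero _ hc), C_1, one_mul] at h2

theorem vanishesToOrder_smul_iff {f : MvPolynomial σ K} {d : ℕ} (hf : f.IsHomogeneous d) {c : K}
    (hc : c ≠ 0) {v : σ → K} {m : ℕ} : VanishesToOrder f (c • v) m ↔ VanishesToOrder f v m := by
  refine ⟨.of_smul hf hc, fun h => .of_smul hf (inv_ne_zero hc) ?_⟩
  rwa [inv_smul_smul₀ hc]

/-- A coordinate-wise substitution `X_j ↦ X_j (X_j + c_j)` with all `c_j ≠ 0` preserves the order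
at the origin. -/
theorem mem_pow_of_aeval_mem_pow {c : σ → K} (hc : ∀ j, c j ≠ 0) {q : MvPolynomial σ K} {m : ℕ}
    (h : aeval (fun j => X j * (X j + C (c j))) q ∈ idealOfVars σ K ^ m) :
    q ∈ idealOfVars σ K ^ m := by
  classical
  rw [mem_pow_idealOfVars_iff'] at h ⊢
  intro b
  induction hn : b.degree using Nat.strong_induction_on generalizing b with
  | _ n ih =>
    subst hn
    intro hb
    -- Coefficients of `q` below `b.degree` are already zero, and any other monomial contributing to
    -- `X ^ b` has smaller degree. Only the lowest term `c ^ b X ^ b` of the image of `X ^ b`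
    -- remains.
    have key : coeff b (aeval (fun j => X j * (X j + C (c j))) q) =
        (b.prod fun j n => c j ^ n) * coeff b q := by
      have hmon : ∀ u : σ →₀ ℕ, aeval (fun j => X j * (X j + C (c j))) (monomial u (coeff u q)) =
          monomial u (coeff u q) * (u.prod fun j n => (X j + C (c j)) ^ n) := by
        intro u
        rw [aeval_monomial, monomial_eq]
        simp only [mul_pow, Finsupp.prod_mul, algebraMap_eq]
        ring
      conv_lhs => rw [q.as_sum, map_sum, coeff_sum]
      simp_rw [hmon, coeff_monomial_mul']
      rw [Finset.sum_eq_single b]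
      · rw [if_pos le_rfl, tsub_self, mul_comm, ← constantCoeff_eq, Finsupp.prod, map_prod]
        simp [Finsupp.prod]
      · intro u _ hub
        split_ifs with hle
        · have hlt : u.degree < b.degree := by
            obtain ⟨w, rfl⟩ := le_iff_exists_add.mp hle
            have : w ≠ 0 := by
              rintro rfl
              simp at hub
            have : w.degree ≠ 0 := mt (Finsupp.degree_eq_zero_iff w).mp this
            rw [map_add]
            omega
          rw [ih _ hlt u rfl (hlt.trans hb), zero_mul]
        · rfl
      · intro hbs
        rw [notMem_support_iff.mp hbs]
        simp
    rw [h b hb] at key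
    exact (mul_eq_zero.mp key.symm).resolve_left
      (Finset.prod_ne_zero_iff.mpr fun j _ => pow_ne_zero _ (hc j))

/-- The map `x ↦ x ^ 2` is étale outside of the coordinate hyperplanes. -/
theorem VanishesToOrder.of_expand_two [NeZero (2 : K)] {g : MvPolynomial σ K} {y : σ → K}
    (hy : ∀ j, y j ≠ 0) {m : ℕ} (h : VanishesToOrder (expand 2 g) y m) :
    VanishesToOrder g (y ^ 2) m := by
  -- The constants come from `(X + y)^2 - y^2 = X (X + 2y)`.
  refine mem_pow_of_aeval_mem_pow (c := fun j => 2 * y j)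
    (fun j => mul_ne_zero two_ne_zero (hy j)) ?_
  have h1 : (translate y).comp (expand 2) =
      (aeval fun j => X j * (X j + C (2 * y j))).comp (translate (y ^ 2)) := by
    ext1 j
    have h2 : (C 2 : MvPolynomial σ K) = 2 := map_ofNat C 2
    simp [translate, h2]
    ring
  have h2 := congrArg (fun φ : MvPolynomial σ K →ₐ[K] MvPolynomial σ K => φ g) h1
  simp only [AlgHom.comp_apply] at h2
  rw [← h2]
  exact h

/-- A polynomial not vanishing at `v` is a unit in the local ring at `v`. -/
theorem VanishesToOrder.of_mul {s f : MvPolynomial σ K} {v : σ → K} {m : ℕ} (hs : eval v s ≠ 0)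
    (h : VanishesToOrder (s * f) v m) : VanishesToOrder f v m := by
  classical
  unfold VanishesToOrder at *
  rw [map_mul] at h
  rw [← constantCoeff_translate] at hs
  generalize translate v s = s at *
  generalize translate v f = f at *
  rw [mem_pow_idealOfVars_iff'] at h ⊢
  intro b
  induction hn : b.degree using Nat.strong_induction_on generalizing b with
  | _ n ih =>
    subst hn
    intro hb
    have key := h b hb
    -- By induction the coefficients of `f` of degree below `b.degree` vanish, which leaves the
    -- constant term of `s` times `coeff b f`.
    rw [coeff_mul, Finset.sum_eq_single (0, b)] at key
    · exact (mul_eq_zero.mp key).resolve_left hs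
    · rintro ⟨u, w⟩ huw hne
      rw [Finset.HasAntidiagonal.mem_antidiagonal] at huw
      simp only at huw ⊢
      have hu : u ≠ 0 := by
        rintro rfl
        rw [zero_add] at huw
        exact hne (by rw [huw])
      have hu : u.degree ≠ 0 := mt (Finsupp.degree_eq_zero_iff u).mp hu
      have hlt : w.degree < b.degree := by
        rw [← huw, map_add]
        omega
      rw [ih _ hlt w rfl (hlt.trans hb), mul_zero]
    · simp

end VanishingOrder

/-! ### Symbolic powers of finite intersections of primes -/

section LocalComparison

variable {R : Type*} [CommRing R]

/-- Among finitely many pairwise incomparable primes, some element lies outside of `P i` and in all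
members different from `P i`. -/
theorem exists_notMem_forall_ne_mem {ι : Type*} [Finite ι] {P : ι → Ideal R}
    (hP : ∀ i, (P i).IsPrime) (hinc : ∀ i j, P i ≤ P j → P i = P j) (i : ι) :
    ∃ s, s ∉ P i ∧ (∀ j, P j ≠ P i → s ∈ P j) := by
  classical
  have := Fintype.ofFinite ι
  have h : ¬ (Finset.univ.filter fun j => P j ≠ P i).inf P ≤ P i := by
    rw [(hP i).inf_le']
    rintro ⟨j, hj, hle⟩
    exact (Finset.mem_filter.mp hj).2 (hinc j i hle)
  obtain ⟨s, hs, hsi⟩ := SetLike.not_le_iff_exists.mp h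
  refine ⟨s, hsi, fun j hj => ?_⟩
  exact (Finset.inf_le (f := P) (Finset.mem_filter.mpr ⟨Finset.mem_univ j, hj⟩)) hs

theorem colon_bot_mk {I : Ideal R} (x : R) :
    (⊥ : Submodule R (R ⧸ I)).colon {Ideal.Quotient.mk I x} = I.colon {x} := by
  ext r
  rw [Submodule.mem_colon_singleton, Submodule.mem_colon_singleton, Submodule.mem_bot,
    smul_eq_mul, ← Ideal.Quotient.eq_zero_iff_mem, map_mul]
  rfl

/-- The associated primes of a finite intersection of pairwise incomparable primes. -/
theorem mem_associatedPrimes_iInf_iff [IsNoetherianRing R] {ι : Type*} [Finite ι]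
    {P : ι → Ideal R} (hP : ∀ i, (P i).IsPrime) (hinc : ∀ i j, P i ≤ P j → P i = P j)
    {Q : Ideal R} : Q ∈ associatedPrimes R (R ⧸ ⨅ i, P i) ↔ ∃ i, P i = Q := by
  classical
  have := Fintype.ofFinite ι
  rw [AssociatedPrimes.mem_iff, isAssociatedPrime_iff]
  constructor
  · rintro ⟨hQ, x, hx⟩
    obtain ⟨x, rfl⟩ := Ideal.Quotient.mk_surjective x
    rw [colon_bot_mk] at hx
    -- The annihilator of the class of `x` is the intersection of the `P i` not containing `x`; a
    -- prime that is a finite intersection is one of its members.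
    have h : Q = (Finset.univ.filter fun i => x ∉ P i).inf P := by
      rw [hx]
      ext r
      rw [Submodule.mem_colon_singleton, smul_eq_mul]
      simp only [Submodule.mem_iInf, Submodule.mem_finsetInf, Finset.mem_filter, Finset.mem_univ,
        true_and]
      refine forall_congr' fun i => ?_
      rw [(hP i).mul_mem_iff_mem_or_mem]
      tauto
    rw [h] at hQ
    obtain ⟨i, -, hi⟩ := Ideal.eq_inf_of_isPrime_inf hQ
    exact ⟨i, hi.trans h.symm⟩
  · rintro ⟨i, rfl⟩
    obtain ⟨s, hs, hsj⟩ := exists_notMem_forall_ne_mem hP hinc i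
    refine ⟨hP i, Ideal.Quotient.mk _ s, ?_⟩
    rw [colon_bot_mk]
    ext r
    rw [Submodule.mem_colon_singleton, smul_eq_mul, Submodule.mem_iInf]
    constructor
    · intro hr j
      by_cases hj : P j = P i
      · exact hj ▸ Ideal.mul_mem_right _ _ hr
      · exact Ideal.mul_mem_left _ _ (hsj j hj)
    · intro h
      exact ((hP i).mem_or_mem (h i)).resolve_right hs

/-- The symbolic power of a finite intersection of pairwise incomparable primes. -/
theorem mem_symbolicPower_iInf_iff [IsNoetherianRing R] {ι : Type*} [Finite ι]
    {P : ι → Ideal R} (hP : ∀ i, (P i).IsPrime) (hinc : ∀ i j, P i ≤ P j → P i = P j)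
    {m : ℕ} {f : R} : f ∈ symbolicPower (⨅ i, P i) m ↔
      ∀ i, ∃ s, s ∉ P i ∧ s * f ∈ (P i) ^ m := by
  unfold symbolicPower
  rw [Submodule.mem_iInf]
  have hloc : ∀ (Q : Ideal R) [Q.IsPrime] (J : Ideal R),
      f ∈ (J.map (algebraMap R (Localization.AtPrime Q))).comap
        (algebraMap R (Localization.AtPrime Q)) ↔ ∃ s, s ∉ Q ∧ s * f ∈ J := by
    intro Q _ J
    rw [Ideal.mem_comap, IsLocalization.algebraMap_mem_map_algebraMap_iff Q.primeCompl]
    rfl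
  constructor
  · intro h i
    have hi := h ⟨P i, (mem_associatedPrimes_iInf_iff hP hinc).mpr ⟨i, rfl⟩⟩
    have := hP i
    obtain ⟨s, hs, hsf⟩ := (hloc (P i) _).mp hi
    exact ⟨s, hs, Ideal.pow_right_mono (iInf_le _ i) m hsf⟩
  · rintro h ⟨Q, hQ⟩
    obtain ⟨i, rfl⟩ := (mem_associatedPrimes_iInf_iff hP hinc).mp hQ
    have := hP i
    refine (hloc (P i) _).mpr ?_
    obtain ⟨s, hs, hsf⟩ := h i
    -- Since `t` lies in all the other primes, `t * P i` lies in the intersection, so `t ^ m`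
    -- carries `P i ^ m` into its `m`-th power.
    obtain ⟨t, ht, htj⟩ := exists_notMem_forall_ne_mem hP hinc i
    refine ⟨t ^ m * s, fun hts => ?_, ?_⟩
    · rcases (hP i).mem_or_mem hts with h1 | h1
      · exact ht ((hP i).mem_of_pow_mem m h1)
      · exact hs h1
    · have hle : Ideal.span {t} * P i ≤ ⨅ j, P j := by
        rw [Ideal.span_singleton_mul_le_iff]
        intro z hz
        rw [Submodule.mem_iInf]
        intro j
        by_cases hj : P j = P i
        · exact hj ▸ Ideal.mul_mem_left _ _ hz
        · exact Ideal.mul_mem_right _ _ (htj j hj)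
      have h2 := Ideal.pow_right_mono hle m
      rw [mul_pow, Ideal.span_singleton_pow] at h2
      rw [mul_assoc]
      exact h2 (Ideal.mul_mem_mul (Ideal.mem_span_singleton_self _) hsf)

end LocalComparison

/-! ### Symbolic powers at points as vanishing conditions -/

section PointIdeal

variable {K : Type*} [Field K] {N : ℕ}

/-- Restriction of polynomials to the line through the origin and `v`. -/
noncomputable def restrictToLine (v : Fin (N + 1) → K) : CoordRing K N →ₐ[K] Polynomial K :=
  aeval fun j => Polynomial.C (v j) * Polynomial.X

theorem eval_restrictToLine (v : Fin (N + 1) → K) (c : K) (f : CoordRing K N) :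
    (restrictToLine v f).eval c = eval (c • v) f := by
  have h : (Polynomial.evalRingHom c).comp (restrictToLine v).toRingHom = eval (c • v) := by
    ext j
    · simp
    · simp [restrictToLine, mul_comm c]
  exact congrArg (fun φ : CoordRing K N →+* K => φ f) h

theorem restrictToLine_of_isHomogeneous (v : Fin (N + 1) → K) {f : CoordRing K N} {d : ℕ}
    (hf : f.IsHomogeneous d) :
    restrictToLine v f = Polynomial.C (eval v f) * Polynomial.X ^ d := by
  rw [restrictToLine, aeval_def, eval₂_eq, eval_eq, map_sum, Finset.sum_mul]
  refine Finset.sum_congr rfl fun b hb => ?_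
  have : b.degree = d := by
    by_contra h
    exact (mem_support_iff.mp hb) (hf.coeff_eq_zero h)
  rw [← this, Finsupp.degree_apply, ← Finset.prod_pow_eq_pow_sum]
  simp only [mul_pow, Finset.prod_mul_distrib, map_mul, map_prod, map_pow]
  rw [mul_assoc, Polynomial.algebraMap_eq]

/-- On the line through `p.rep`, the degree `d` component of `f` becomes its value at `p.rep` times
`X ^ d`, so components of different degrees cannot cancel. Primality follows because the target is a
domain. -/
theorem pointIdeal_eq_ker (p : ProjPoint K N) :
    pointIdeal p = RingHom.ker (restrictToLine p.rep) := by
  apply le_antisymm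
  · rw [pointIdeal, Ideal.span_le]
    rintro f ⟨⟨d, hd⟩, hf⟩
    rw [SetLike.mem_coe, RingHom.mem_ker, restrictToLine_of_isHomogeneous _ hd, hf]
    simp
  · intro f hf
    rw [RingHom.mem_ker, ← sum_homogeneousComponent f, map_sum] at hf
    rw [← sum_homogeneousComponent f]
    refine Ideal.sum_mem _ fun d hd => Ideal.subset_span
      ⟨⟨d, homogeneousComponent_isHomogeneous d f⟩, ?_⟩
    have h := congrArg (fun q => Polynomial.coeff q d) hf
    simp only [restrictToLine_of_isHomogeneous _ (homogeneousComponent_isHomogeneous _ f),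
      Polynomial.finsetSum_coeff, Polynomial.coeff_C_mul_X_pow, Polynomial.coeff_zero] at h
    rw [Finset.sum_ite_eq, if_pos hd] at h
    exact h

theorem isPrime_pointIdeal (p : ProjPoint K N) : (pointIdeal p).IsPrime := by
  rw [pointIdeal_eq_ker]
  exact RingHom.ker_isPrime _

theorem mem_pointIdeal_iff_of_isHomogeneous {p : ProjPoint K N} {f : CoordRing K N} {d : ℕ}
    (hf : f.IsHomogeneous d) : f ∈ pointIdeal p ↔ eval p.rep f = 0 := by
  rw [pointIdeal_eq_ker, RingHom.mem_ker, restrictToLine_of_isHomogeneous _ hf]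
  simp

theorem eq_of_pointIdeal_le {p q : ProjPoint K N} (h : pointIdeal p ≤ pointIdeal q) : p = q := by
  obtain ⟨j, hj⟩ := Function.ne_iff.mp p.rep_nonzero
  have key : ∀ i, p.rep j * q.rep i = p.rep i * q.rep j := by
    intro i
    have hhom : (C (p.rep j) * X i - C (p.rep i) * X j : CoordRing K N).IsHomogeneous 1 :=
      (isHomogeneous_C_mul_X _ _).sub (isHomogeneous_C_mul_X _ _)
    have h1 := h ((mem_pointIdeal_iff_of_isHomogeneous hhom).mpr (by simp [mul_comm]))
    rw [mem_pointIdeal_iff_of_isHomogeneous hhom] at h1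
    simpa [sub_eq_zero] using h1
  rw [← p.mk_rep, ← q.mk_rep, eq_comm, Projectivization.mk_eq_mk_iff']
  refine ⟨q.rep j / p.rep j, ?_⟩
  ext i
  have := key i
  simp only [Pi.smul_apply, smul_eq_mul]
  rw [div_mul_eq_mul_div, div_eq_iff hj]
  linear_combination -this

theorem translate_mem_pow_of_mem_pointIdeal_pow {p : ProjPoint K N} {f : CoordRing K N} {m : ℕ}
    (hf : f ∈ pointIdeal p ^ m) (c : K) : VanishesToOrder f (c • p.rep) m := by
  have h : (pointIdeal p).map (translate (c • p.rep)) ≤ idealOfVars _ K := by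
    rw [Ideal.map_le_iff_le_comap]
    intro g hg
    rw [Ideal.mem_comap, translate_mem_idealOfVars, ← eval_restrictToLine]
    rw [pointIdeal_eq_ker, RingHom.mem_ker] at hg
    rw [hg, Polynomial.eval_zero]
  have := Ideal.mem_map_of_mem (translate (c • p.rep)) hf
  rw [Ideal.map_pow] at this
  exact Ideal.pow_right_mono h m this

/-- A denominator `s` need not be homogeneous and may vanish at `p.rep` itself, but not on the whole
punctured line; orders are therefore compared at a multiple `c • p.rep`. -/
theorem exists_eval_smul_rep_ne_zero [Infinite K] {p : ProjPoint K N} {s : CoordRing K N}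
    (hs : s ∉ pointIdeal p) : ∃ c : K, c ≠ 0 ∧ eval (c • p.rep) s ≠ 0 := by
  rw [pointIdeal_eq_ker, RingHom.mem_ker] at hs
  by_contra! h
  have h0 : Polynomial.X * restrictToLine p.rep s = 0 := by
    apply Polynomial.funext
    intro c
    by_cases hc : c = 0
    · simp [hc]
    · rw [Polynomial.eval_mul, eval_restrictToLine, h c hc]
      simp
  exact hs ((mul_eq_zero.mp h0).resolve_left Polynomial.X_ne_zero)

/-- A form that vanishes to order `m` at `p` is locally in the `m`-th power of the ideal of `p`. -/
theorem exists_mul_mem_pow_of_vanishesToOrder {p : ProjPoint K N} {f : CoordRing K N} {d m : ℕ}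
    (hf : f.IsHomogeneous d) (h : VanishesToOrder f p.rep m) :
    ∃ s, s ∉ pointIdeal p ∧ s * f ∈ pointIdeal p ^ m := by
  have := isPrime_pointIdeal p
  obtain ⟨j, hj⟩ := Function.ne_iff.mp p.rep_nonzero
  set w := p.rep with hw
  set A := Localization.AtPrime (pointIdeal p)
  -- `T` takes the value 1 at `w` and is a unit in the local ring. With `Y_i = X_i - w_i T`, which
  -- vanishes at `p`, one has `X_i / T = w_i + Y_i / T`. Homogeneity then gives `f = T^d f(X / T)`,
  -- the Taylor expansion at `w` evaluated at `Y / T`.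
  set T : CoordRing K N := C (w j)⁻¹ * X j with hT
  have hTmem : T ∉ pointIdeal p := by
    rw [mem_pointIdeal_iff_of_isHomogeneous (isHomogeneous_C_mul_X _ _), ← hw]
    simpa using hj
  have hTu : IsUnit (algebraMap (CoordRing K N) A T) :=
    IsLocalization.map_units A (⟨T, hTmem⟩ : (pointIdeal p).primeCompl)
  obtain ⟨u, hu⟩ := hTu
  set Y : Fin (N + 1) → CoordRing K N := fun i => X i - C (w i) * T with hY
  have hYmem : ∀ i, Y i ∈ pointIdeal p := by
    intro i
    have hhom : (Y i).IsHomogeneous 1 :=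
      (isHomogeneous_X _ _).sub (by simpa using (isHomogeneous_C_mul_X (w j)⁻¹ j).C_mul (w i))
    rw [mem_pointIdeal_iff_of_isHomogeneous hhom, ← hw]
    have : w j ≠ 0 := hj
    simp [hY, hT, this]
  set ψ : CoordRing K N →ₐ[K] A :=
    aeval fun i => ↑u⁻¹ * algebraMap (CoordRing K N) A (Y i) with hψ
  have hloc : algebraMap (CoordRing K N) A f = (u : A) ^ d * ψ (translate w f) := by
    have h1 : ψ.comp (translate w) = aeval fun i => ↑u⁻¹ * algebraMap (CoordRing K N) A (X i) := by
      ext i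
      have : algebraMap K A (w i) = ↑u⁻¹ * (algebraMap (CoordRing K N) A (C (w i)) * u) := by
        rw [mul_comm, mul_assoc, Units.mul_inv, mul_one, ← algebraMap_eq,
          ← IsScalarTower.algebraMap_apply]
      simp only [AlgHom.comp_apply, translate, aeval_X, map_add, hψ, aeval_C, this, hY, map_sub,
        map_mul, hu]
      ring
    have h2 := congrArg (fun φ : CoordRing K N →ₐ[K] A => φ f) h1
    simp only [AlgHom.comp_apply] at h2
    rw [h2, aeval_def, eval₂_eq, Finset.mul_sum]
    conv_lhs => rw [f.as_sum, map_sum]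
    refine Finset.sum_congr rfl fun b hb => ?_
    have hb : b.degree = d := by
      by_contra h
      exact (mem_support_iff.mp hb) (hf.coeff_eq_zero h)
    rw [monomial_eq, Finsupp.prod]
    simp only [map_mul, map_prod, map_pow, mul_pow, Finset.prod_mul_distrib]
    rw [Finset.prod_pow_eq_pow_sum, ← Finsupp.degree_apply, hb, ← algebraMap_eq,
      ← IsScalarTower.algebraMap_apply]
    have : (u : A) ^ d * ↑u⁻¹ ^ d = 1 := by rw [← mul_pow, Units.mul_inv, one_pow]
    linear_combination (-(algebraMap K A (coeff b f)) *
      ∏ x ∈ b.support, algebraMap (CoordRing K N) A (X x) ^ b x) * this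
  have hψle : (idealOfVars _ K).map ψ ≤ (pointIdeal p).map (algebraMap (CoordRing K N) A) := by
    rw [Ideal.map_span, Ideal.span_le]
    rintro _ ⟨_, ⟨i, rfl⟩, rfl⟩
    simp only [hψ, aeval_X]
    exact Ideal.mul_mem_left _ _ (Ideal.mem_map_of_mem _ (hYmem i))
  have hmem : algebraMap (CoordRing K N) A f ∈
      (pointIdeal p ^ m).map (algebraMap (CoordRing K N) A) := by
    rw [hloc, Ideal.map_pow]
    refine Ideal.mul_mem_left _ _ (Ideal.pow_right_mono hψle m ?_)
    rw [← Ideal.map_pow]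
    exact Ideal.mem_map_of_mem ψ h
  rw [IsLocalization.algebraMap_mem_map_algebraMap_iff (pointIdeal p).primeCompl] at hmem
  exact hmem

/-- The forms in the symbolic powers of the ideal of simple points. -/
theorem mem_symbolicPower_pointsIdeal_iff [Infinite K] {n : ℕ} {p : Fin n → ProjPoint K N}
    {f : CoordRing K N} {d m : ℕ} (hf : f.IsHomogeneous d) :
    f ∈ symbolicPower (pointsIdeal p) m ↔ ∀ i, VanishesToOrder f (p i).rep m := by
  rw [pointsIdeal, mem_symbolicPower_iInf_iff (fun i => isPrime_pointIdeal (p i))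
    (fun i j h => by rw [eq_of_pointIdeal_le h])]
  refine forall_congr' fun i => ⟨?_, exists_mul_mem_pow_of_vanishesToOrder hf⟩
  rintro ⟨s, hs, hsf⟩
  obtain ⟨c, hc, hcs⟩ := exists_eval_smul_rep_ne_zero hs
  exact ((translate_mem_pow_of_mem_pointIdeal_pow hsf c).of_mul hcs).of_smul hf hc

end PointIdeal

/-! ### Openness of the absence of forms -/

section Semicontinuity

variable {K σ ι : Type*} [Field K]

/-- There is a nonzero form of degree `d` vanishing to order `m` at all vectors `v i`. -/
def HasForm (v : ι → σ → K) (d m : ℕ) : Prop :=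
  ∃ f : MvPolynomial σ K, f.IsHomogeneous d ∧ f ≠ 0 ∧ ∀ i, VanishesToOrder f (v i) m

/-- The coefficient of `X ^ a` in `(X + v i) ^ c` as a polynomial in `v`. -/
noncomputable def taylorCoeff (K : Type*) [Field K] (i : ι) (a c : σ →₀ ℕ) :
    MvPolynomial (ι × σ) K :=
  coeff a (aeval (fun j => (X j + C (X (i, j)) : MvPolynomial σ (MvPolynomial (ι × σ) K)))
    (monomial c (1 : K)))

theorem eval_taylorCoeff (v : ι → σ → K) (i : ι) (a c : σ →₀ ℕ) :
    eval (fun ij => v ij.1 ij.2) (taylorCoeff K i a c) =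
      coeff a (translate (v i) (monomial c 1)) := by
  rw [taylorCoeff, ← coeff_map]
  congr 1
  have h : (mapAlgHom (aeval fun ij : ι × σ => v ij.1 ij.2)).comp
      (aeval (fun j => (X j + C (X (i, j)) : MvPolynomial σ (MvPolynomial (ι × σ) K)))) =
      translate (v i) := by
    ext1 j
    simp [translate]
  exact congrArg (fun φ : MvPolynomial σ K →ₐ[K] MvPolynomial σ K => φ (monomial c 1)) h

theorem coeff_translate_eq_sum (v : σ → K) (a : σ →₀ ℕ) {f : MvPolynomial σ K} {s : Finset (σ →₀ ℕ)}
    (hs : f.support ⊆ s) :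
    coeff a (translate v f) = ∑ c ∈ s, coeff a (translate v (monomial c 1)) * coeff c f := by
  conv_lhs => rw [f.as_sum, map_sum, coeff_sum]
  rw [Finset.sum_subset hs]
  · refine Finset.sum_congr rfl fun c _ => ?_
    rw [← mul_one (coeff c f), ← smul_eq_mul, ← smul_monomial, map_smul, coeff_smul, smul_eq_mul,
      smul_eq_mul, mul_one, mul_comm]
  · intro c _ hc
    rw [notMem_support_iff.mp hc]
    simp

/-- The absence of forms with prescribed degree and vanishing orders is a Zariski open condition
on the points. -/
theorem exists_open_not_hasForm [Finite σ] [Finite ι] {v₀ : ι → σ → K} {d m : ℕ}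
    (h₀ : ¬ HasForm v₀ d m) : ∃ F : MvPolynomial (ι × σ) K, F ≠ 0 ∧
      ∀ v : ι → σ → K, eval (fun ij => v ij.1 ij.2) F ≠ 0 → ¬ HasForm v d m := by
  classical
  have := Fintype.ofFinite ι
  have hcol : {c : σ →₀ ℕ | c.degree = d}.Finite :=
    (Finsupp.finite_of_degree_le d).subset fun c (hc : c.degree = d) => hc.le
  have hrow : {a : σ →₀ ℕ | a.degree < m}.Finite :=
    (Finsupp.finite_of_degree_le m).subset fun c (hc : c.degree < m) => hc.le
  have : Fintype {c : σ →₀ ℕ // c.degree = d} := hcol.fintype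
  have : Fintype {a : σ →₀ ℕ // a.degree < m} := hrow.fintype
  -- Kernel vectors of `A` at `v` are the forms of degree `d` with order `m` at all `v i`: one
  -- equation per point and Taylor coefficient of degree below `m`.
  let A : Matrix (ι × {a : σ →₀ ℕ // a.degree < m}) {c : σ →₀ ℕ // c.degree = d}
      (MvPolynomial (ι × σ) K) := Matrix.of fun r c => taylorCoeff K r.1 r.2.1 c.1
  have hsum : ∀ (v : σ → K) (a : σ →₀ ℕ) (f : MvPolynomial σ K), f.IsHomogeneous d →
      coeff a (translate v f) = ∑ c : {c : σ →₀ ℕ // c.degree = d},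
        coeff a (translate v (monomial c.1 1)) * coeff c.1 f := by
    intro v a f hf
    rw [coeff_translate_eq_sum v a (s := hcol.toFinset)]
    · rw [← Finset.sum_coe_sort hcol.toFinset]
      refine Fintype.sum_equiv (Equiv.subtypeEquivRight fun c => by simp) _ _ fun c => rfl
    · intro c hc
      rw [Set.Finite.mem_toFinset]
      by_contra h
      exact (mem_support_iff.mp hc) (hf.coeff_eq_zero h)
  have hmul : ∀ (v : ι → σ → K) (f : MvPolynomial σ K), f.IsHomogeneous d →
      ((A.map (eval fun ij => v ij.1 ij.2)).mulVec (fun c => coeff c.1 f) = 0 ↔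
        ∀ i, VanishesToOrder f (v i) m) := by
    intro v f hf
    simp only [funext_iff, Matrix.mulVec, dotProduct, Matrix.map_apply, Matrix.of_apply, A, eval_taylorCoeff,
      VanishesToOrder, mem_pow_idealOfVars_iff', Pi.zero_apply]
    constructor
    · intro h i a ha
      rw [hsum _ _ _ hf]
      exact h (i, ⟨a, ha⟩)
    · rintro h ⟨i, a, ha⟩
      rw [← hsum _ _ _ hf]
      exact h i a ha
  have hinj : LinearMap.ker (A.map (eval fun ij => v₀ ij.1 ij.2)).mulVecLin = ⊥ := by
    rw [LinearMap.ker_eq_bot']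
    intro x hx
    by_contra hx0
    set q : MvPolynomial σ K := ∑ c : {c : σ →₀ ℕ // c.degree = d}, monomial c.1 (x c) with hq
    have hcoeff : (fun c : {c : σ →₀ ℕ // c.degree = d} => coeff c.1 q) = x := by
      funext b
      rw [hq, coeff_sum, Finset.sum_eq_single b]
      · rw [coeff_monomial, if_pos rfl]
      · intro c _ hc
        rw [coeff_monomial, if_neg fun h => hc (Subtype.ext h)]
      · simp
    have hhom : q.IsHomogeneous d :=
      IsHomogeneous.sum _ _ _ fun c _ => isHomogeneous_monomial _ c.2
    refine h₀ ⟨q, hhom, fun h => hx0 ?_, ?_⟩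
    · rw [← hcoeff, h]
      funext c
      simp
    · rw [← hmul v₀ _ hhom, hcoeff]
      exact hx
  obtain ⟨g, hg⟩ := LinearMap.exists_leftInverse_of_injective _ hinj
  -- A constant left inverse of `A` at `v₀` replaces the choice of a maximal minor: `det (L * A)` is
  -- 1 at `v₀`, and `A` is injective wherever it is nonzero.
  let L : Matrix {c : σ →₀ ℕ // c.degree = d} (ι × {a : σ →₀ ℕ // a.degree < m})
      (MvPolynomial (ι × σ) K) := (LinearMap.toMatrix' g).map C
  have hev : ∀ v : ι → σ → K, eval (fun ij => v ij.1 ij.2) (Matrix.det (L * A)) =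
      Matrix.det (LinearMap.toMatrix' g * A.map (eval fun ij => v ij.1 ij.2)) := by
    intro v
    rw [RingHom.map_det, RingHom.mapMatrix_apply, Matrix.map_mul, Matrix.map_map]
    congr 2
    ext i j
    simp
  refine ⟨Matrix.det (L * A), fun h => ?_, ?_⟩
  · have h1 := hev v₀
    rw [h, map_zero, ← LinearMap.toMatrix'_toLin' (A.map _), Matrix.toLin'_apply', ← LinearMap.toMatrix'_comp, hg,
      LinearMap.toMatrix'_id, Matrix.det_one] at h1
    exact zero_ne_one h1
  · rintro v hv ⟨f, hf, hf0, hfv⟩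
    rw [hev] at hv
    rw [← hmul v f hf] at hfv
    have h1 := Matrix.eq_zero_of_mulVec_eq_zero hv
      (v := fun c : {c : σ →₀ ℕ // c.degree = d} => coeff c.1 f)
      (by rw [← Matrix.mulVec_mulVec, hfv, Matrix.mulVec_zero])
    refine hf0 (MvPolynomial.ext _ _ fun b => ?_)
    by_cases hb : b.degree = d
    · exact congrFun h1 ⟨b, hb⟩
    · simpa using hf.coeff_eq_zero hb

end Semicontinuity

/-! ### The maximal least degree and its general attainment -/

section MaximalLeastDegree

variable {K σ ι : Type*} [Field K]

theorem exists_linear_form [Nontrivial σ] (v : σ → K) :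
    ∃ f : MvPolynomial σ K, f.IsHomogeneous 1 ∧ f ≠ 0 ∧ VanishesToOrder f v 1 := by
  classical
  obtain ⟨i, j, hij⟩ := exists_pair_ne σ
  have hord : ∀ f : MvPolynomial σ K, eval v f = 0 → VanishesToOrder f v 1 := by
    intro f hf
    rwa [VanishesToOrder, pow_one, translate_mem_idealOfVars]
  by_cases hv : v i = 0
  · exact ⟨X i, isHomogeneous_X _ _, X_ne_zero i, hord _ (by simpa using hv)⟩
  · refine ⟨C (v j) * X i - C (v i) * X j,
      (isHomogeneous_C_mul_X _ _).sub (isHomogeneous_C_mul_X _ _), fun h => hv ?_,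
      hord _ (by simp [mul_comm])⟩
    have := congrArg (coeff (Finsupp.single j 1)) h
    simpa [coeff_C_mul, coeff_X, Finsupp.single_left_inj, hij] using this

theorem HasForm.mul {v : ι → σ → K} {d e a b : ℕ} (h₁ : HasForm v d a) (h₂ : HasForm v e b) :
    HasForm v (d + e) (a + b) := by
  obtain ⟨f, hf, hf0, hfv⟩ := h₁
  obtain ⟨g, hg, hg0, hgv⟩ := h₂
  exact ⟨f * g, hf.mul hg, mul_ne_zero hf0 hg0, fun i => (hfv i).mul (hgv i)⟩

theorem hasForm_card_mul [Nontrivial σ] [Fintype ι] (v : ι → σ → K) (m : ℕ) :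
    HasForm v (Fintype.card ι * m) m := by
  classical
  choose f hf hf0 hfv using fun i => exists_linear_form (v i)
  refine ⟨(∏ i, f i) ^ m, ?_, pow_ne_zero _ (Finset.prod_ne_zero_iff.mpr fun i _ => hf0 i), ?_⟩
  · have := (IsHomogeneous.prod Finset.univ f (fun _ => 1) fun i _ => hf i).pow m
    simpa using this
  · intro i
    have h1 : VanishesToOrder (∏ i, f i) (v i) 1 := by
      rw [VanishesToOrder, map_prod, ← Finset.mul_prod_erase _ _ (Finset.mem_univ i)]
      exact Ideal.mul_mem_right _ _ (hfv i)
    simpa using h1.pow m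

/-- The least degree of a nonzero form vanishing to order `m` at all vectors `v i`. -/
noncomputable def leastDegree (v : ι → σ → K) (m : ℕ) : ℕ :=
  sInf {d | HasForm v d m}

variable (K σ) in
/-- The maximal value of `leastDegree v m` for `n` vectors. -/
noncomputable def maxLeastDegree (n m : ℕ) : ℕ :=
  sInf {d | ∀ v : Fin n → σ → K, HasForm v d m}

theorem leastDegree_le {v : ι → σ → K} {d m : ℕ} (h : HasForm v d m) : leastDegree v m ≤ d :=
  Nat.sInf_le h

theorem hasForm_leastDegree [Nontrivial σ] [Fintype ι] (v : ι → σ → K) (m : ℕ) :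
    HasForm v (leastDegree v m) m :=
  Nat.sInf_mem (s := {d | HasForm v d m}) ⟨_, hasForm_card_mul v m⟩

theorem hasForm_maxLeastDegree [Nontrivial σ] {n : ℕ} (v : Fin n → σ → K) (m : ℕ) :
    HasForm v (maxLeastDegree K σ n m) m :=
  Nat.sInf_mem (s := {d | ∀ v : Fin n → σ → K, HasForm v d m})
    ⟨_, fun v => hasForm_card_mul v m⟩ v

theorem maxLeastDegree_le {n m d : ℕ} (h : ∀ v : Fin n → σ → K, HasForm v d m) :
    maxLeastDegree K σ n m ≤ d :=
  Nat.sInf_le h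

variable (K σ) in
-- Each degree below the maximum fails for some configuration, hence on a nonempty open set. Only
-- finitely many degrees occur, so the product of the defining polynomials excludes them all.
theorem exists_open_leastDegree_eq [Nontrivial σ] [Finite σ] (n m : ℕ) :
    ∃ F : MvPolynomial (Fin n × σ) K, F ≠ 0 ∧ ∀ v : Fin n → σ → K,
      eval (fun ij => v ij.1 ij.2) F ≠ 0 → leastDegree v m = maxLeastDegree K σ n m := by
  classical
  have h : ∀ d : Fin (maxLeastDegree K σ n m), ∃ F : MvPolynomial (Fin n × σ) K, F ≠ 0 ∧
      ∀ v : Fin n → σ → K, eval (fun ij => v ij.1 ij.2) F ≠ 0 → ¬ HasForm v d m := by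
    intro d
    have := Nat.notMem_of_lt_sInf d.2
    simp only [Set.mem_ofPred_eq, not_forall] at this
    obtain ⟨v₀, hv₀⟩ := this
    exact exists_open_not_hasForm hv₀
  choose F hF0 hF using h
  refine ⟨∏ d, F d, Finset.prod_ne_zero_iff.mpr fun d _ => hF0 d, fun v hv => ?_⟩
  rw [map_prod, Finset.prod_ne_zero_iff] at hv
  refine le_antisymm (leastDegree_le (hasForm_maxLeastDegree v m)) ?_
  by_contra hlt
  exact hF ⟨_, not_le.mp hlt⟩ v (hv _ (Finset.mem_univ _)) (hasForm_leastDegree v m)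

theorem exists_eval_ne_zero [Infinite K] {τ : Type*} {F : MvPolynomial τ K} (hF : F ≠ 0) :
    ∃ x : τ → K, eval x F ≠ 0 := by
  by_contra! h
  exact hF (MvPolynomial.funext fun x => by rw [h x, map_zero])

variable (K σ) in
theorem maxLeastDegree_add_le [Nontrivial σ] (n a b : ℕ) :
    maxLeastDegree K σ n (a + b) ≤ maxLeastDegree K σ n a + maxLeastDegree K σ n b :=
  maxLeastDegree_le fun v => (hasForm_maxLeastDegree v a).mul (hasForm_maxLeastDegree v b)

variable (K σ) in
theorem maxLeastDegree_mono [Nontrivial σ] {k n : ℕ} (h : k ≤ n) (m : ℕ) :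
    maxLeastDegree K σ k m ≤ maxLeastDegree K σ n m := by
  refine maxLeastDegree_le fun v => ?_
  -- Padding with zero vectors is harmless, since `maxLeastDegree` bounds all tuples of vectors.
  obtain ⟨f, hf, hf0, hfv⟩ := hasForm_maxLeastDegree
    (fun i : Fin n => if hi : (i : ℕ) < k then v ⟨i, hi⟩ else 0) m
  refine ⟨f, hf, hf0, fun i => ?_⟩
  simpa using hfv (Fin.castLE h i)

end MaximalLeastDegree

/-! ### Sign changes and the squaring map -/

section SignChanges

variable {K : Type*} [Field K]

/-- The vector of signs `(1, ε)`. -/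
def signVector (K : Type*) [Field K] (ε : Fin 3 → ℤˣ) : Fin 4 → K :=
  Fin.cons 1 fun j => ((ε j : ℤ) : K)

theorem signVector_mul (δ ε : Fin 3 → ℤˣ) :
    signVector K (δ * ε) = signVector K δ * signVector K ε := by
  funext j
  refine Fin.cases ?_ (fun j => ?_) j <;> simp [signVector]

theorem signVector_ne_zero (ε : Fin 3 → ℤˣ) (j : Fin 4) : signVector K ε j ≠ 0 := by
  refine Fin.cases ?_ (fun j => ?_) j
  · simp [signVector]
  · rcases Int.units_eq_one_or (ε j) with h | h <;> simp [signVector, h]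

theorem rescale_rescale {σ : Type*} (a b : σ → K) (f : MvPolynomial σ K) :
    rescale a (rescale b f) = rescale (a * b) f := by
  ext u
  simp only [coeff_rescale, Finsupp.prod, Pi.mul_apply, mul_pow, Finset.prod_mul_distrib]
  ring

/-- The product of all sign changes of a form. -/
noncomputable def signNorm (f : MvPolynomial (Fin 4) K) : MvPolynomial (Fin 4) K :=
  ∏ ε : Fin 3 → ℤˣ, rescale (signVector K ε) f

theorem rescale_signNorm (δ : Fin 3 → ℤˣ) (f : MvPolynomial (Fin 4) K) :
    rescale (signVector K δ) (signNorm f) = signNorm f := by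
  rw [signNorm, map_prod]
  refine Fintype.prod_equiv (Equiv.mulLeft δ) _ _ fun ε => ?_
  rw [rescale_rescale, ← signVector_mul]
  rfl

theorem card_signs : Fintype.card (Fin 3 → ℤˣ) = 8 := by simp

theorem isHomogeneous_signNorm {f : MvPolynomial (Fin 4) K} {d : ℕ} (hf : f.IsHomogeneous d) :
    (signNorm f).IsHomogeneous (8 * d) := by
  have := IsHomogeneous.prod Finset.univ (fun ε => rescale (signVector K ε) f) (fun _ => d)
    fun ε _ => isHomogeneous_rescale _ hf
  rwa [Finset.sum_const, Finset.card_univ, card_signs, smul_eq_mul] at this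

theorem signNorm_ne_zero {f : MvPolynomial (Fin 4) K} (hf : f ≠ 0) : signNorm f ≠ 0 := by
  refine Finset.prod_ne_zero_iff.mpr fun ε _ h => hf ?_
  exact rescale_injective (signVector_ne_zero ε) (h.trans (map_zero _).symm)

theorem VanishesToOrder.signNorm {f : MvPolynomial (Fin 4) K} {y : Fin 4 → K} {m : ℕ}
    (h : ∀ ε, VanishesToOrder f (signVector K ε * y) m) :
    VanishesToOrder (signNorm f) y (8 * m) := by
  have := VanishesToOrder.prod Finset.univ (f := fun ε => GenericPoints.rescale (signVector K ε) f)
    (v := y) (m := m) fun ε _ => (h ε).rescale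
  rwa [Finset.card_univ, card_signs] at this

theorem even_of_coeff_signNorm_ne_zero [CharZero K] {f : MvPolynomial (Fin 4) K} {d : ℕ}
    (hf : f.IsHomogeneous d) {b : Fin 4 →₀ ℕ} (hb : coeff b (signNorm f) ≠ 0) (i : Fin 4) :
    Even (b i) := by
  have hsucc : ∀ j : Fin 3, Even (b j.succ) := by
    intro j
    have h := congrArg (coeff b) (rescale_signNorm (Pi.mulSingle j (-1)) f)
    rw [coeff_rescale] at h
    have h1 := mul_right_cancel₀ hb (h.trans (one_mul _).symm)
    rw [Finsupp.prod_fintype _ _ (by simp), Fin.prod_univ_succ, Finset.prod_eq_single j] at h1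
    · rw [← neg_one_pow_eq_one_iff_even (R := K) (by norm_num)]
      simpa [signVector] using h1
    · intro k _ hk
      simp [signVector, hk]
    · simp
  -- The signs fix coordinate 0; its exponent is even because the total degree `8 * d` and the other
  -- exponents are.
  refine Fin.cases ?_ hsucc i
  have hdeg : b.degree = 8 * d := by
    by_contra h
    exact hb ((isHomogeneous_signNorm hf).coeff_eq_zero h)
  rw [Finsupp.degree_eq_sum, Fin.sum_univ_succ] at hdeg
  have h1 : Even (∑ j : Fin 3, b j.succ) := Finset.even_sum _ fun j _ => hsucc j
  have h2 : Even (b 0 + ∑ j : Fin 3, b j.succ) := by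
    rw [hdeg]
    exact Even.mul_right (by decide) _
  exact (Nat.even_add.mp h2).mpr h1

theorem exists_expand_eq_signNorm [CharZero K] {f : MvPolynomial (Fin 4) K} {d : ℕ}
    (hf : f.IsHomogeneous d) :
    ∃ g : MvPolynomial (Fin 4) K, g.IsHomogeneous (4 * d) ∧ expand 2 g = signNorm f := by
  have h : ∀ b : (signNorm f).support, ∃ c : Fin 4 →₀ ℕ, 2 • c = b.1 := by
    rintro ⟨b, hb⟩
    refine ⟨b.mapRange (· / 2) rfl, Finsupp.ext fun i => ?_⟩
    have := even_of_coeff_signNorm_ne_zero hf (mem_support_iff.mp hb) i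
    simpa using Nat.mul_div_cancel' this.two_dvd
  choose c hc using h
  refine ⟨∑ b : (signNorm f).support, monomial (c b) (coeff b.1 (signNorm f)),
    IsHomogeneous.sum _ _ _ fun b _ => isHomogeneous_monomial _ ?_, ?_⟩
  · have hdeg : b.1.degree = 8 * d := by
      by_contra h
      exact (mem_support_iff.mp b.2) ((isHomogeneous_signNorm hf).coeff_eq_zero h)
    rw [← hc b, map_nsmul, smul_eq_mul] at hdeg
    omega
  · rw [map_sum]
    simp_rw [expand_monomial, hc]
    rw [Finset.sum_coe_sort (signNorm f).support
      (fun b => monomial b (coeff b (signNorm f))), ← as_sum]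

variable (K) in
theorem maxLeastDegree_eight_mul_le [CharZero K] (a m : ℕ) :
    maxLeastDegree K (Fin 4) a (8 * m) ≤ 4 * maxLeastDegree K (Fin 4) (a * 8) m := by
  classical
  obtain ⟨F, hF0, hF⟩ := exists_open_leastDegree_eq K (Fin 4) a (8 * m)
  -- Choose `y` off the coordinate hyperplanes with `F (y ^ 2) ≠ 0`: the squares are then general
  -- enough to attain the maximum.
  obtain ⟨y, hy⟩ := exists_eval_ne_zero
    (mul_ne_zero ((expand_ne_zero two_pos).mpr hF0) (Finset.prod_ne_zero_iff (s := Finset.univ)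
      (f := fun ij : Fin a × Fin 4 => (X ij : MvPolynomial (Fin a × Fin 4) K)).mpr
        fun ij _ => X_ne_zero ij))
  rw [map_mul, mul_ne_zero_iff, eval_expand, map_prod, Finset.prod_ne_zero_iff] at hy
  obtain ⟨hyF, hy⟩ := hy
  simp only [Finset.mem_univ, eval_X, true_implies] at hy
  obtain ⟨z, hz⟩ : ∃ z : Fin a → Fin 4 → K, ∀ i j, z i j = y (i, j) := ⟨fun i j => y (i, j),
    fun _ _ => rfl⟩
  have hzF : y ^ 2 = fun ij : Fin a × Fin 4 => (z ij.1 ^ 2) ij.2 := by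
    funext ij
    rw [Pi.pow_apply, Pi.pow_apply, hz]
  rw [hzF] at hyF
  rw [← hF (fun i => z i ^ 2) hyF]
  obtain ⟨e⟩ : Nonempty (Fin (a * 8) ≃ Fin a × (Fin 3 → ℤˣ)) := by
    rw [← Fintype.card_eq, Fintype.card_prod, card_signs, Fintype.card_fin, Fintype.card_fin]
  -- The `8a` sign changes form a special configuration, but the maximal least degree applies to it
  -- too.
  obtain ⟨f, hf, hf0, hfv⟩ := hasForm_maxLeastDegree
    (fun i : Fin (a * 8) => signVector K (e i).2 * z (e i).1) m
  obtain ⟨g, hg, hgf⟩ := exists_expand_eq_signNorm hf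
  refine leastDegree_le ⟨g, hg, ?_, fun i => ?_⟩
  · rintro rfl
    exact signNorm_ne_zero hf0 (by rw [← hgf, map_zero])
  · refine VanishesToOrder.of_expand_two (fun j => hz i j ▸ hy (i, j)) ?_
    rw [hgf]
    refine VanishesToOrder.signNorm fun ε => ?_
    simpa using hfv (e.symm (i, ε))

end SignChanges

/-! ### Generic values and Waldschmidt constants -/

section GeneralPoints

variable {K : Type*} [Field K] [Infinite K] {N n : ℕ}

theorem alpha_symbolicPower_eq_leastDegree {p : Fin n → ProjPoint K N}
    {v : Fin n → Fin (N + 1) → K} (hv : ∀ i, v i ≠ 0)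
    (hp : ∀ i, p i = Projectivization.mk K (v i) (hv i)) (m : ℕ) :
    alpha (symbolicPower (pointsIdeal p) m) = leastDegree v m := by
  unfold alpha leastDegree
  congr 1
  ext d
  refine exists_congr fun f => ?_
  constructor
  · rintro ⟨hfm, hf, hf0⟩
    refine ⟨hf, hf0, fun i => ?_⟩
    obtain ⟨c, hc⟩ := Projectivization.exists_smul_eq_mk_rep K (v i) (hv i)
    have := (mem_symbolicPower_pointsIdeal_iff hf).mp hfm i
    rw [hp i, ← hc] at this
    exact this.of_smul hf c.ne_zero
  · rintro ⟨hf, hf0, hfv⟩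
    refine ⟨(mem_symbolicPower_pointsIdeal_iff hf).mpr fun i => ?_, hf, hf0⟩
    obtain ⟨c, hc⟩ := Projectivization.exists_smul_eq_mk_rep K (v i) (hv i)
    rw [hp i, ← hc]
    exact (vanishesToOrder_smul_iff hf c.ne_zero).mpr (hfv i)

theorem exists_general_of_ne_zero {F : MvPolynomial (Fin n × Fin (N + 1)) K} (hF : F ≠ 0) :
    ∃ (v : Fin n → Fin (N + 1) → K) (_ : ∀ i, v i ≠ 0), eval (fun ij => v ij.1 ij.2) F ≠ 0 := by
  -- The extra factor makes every coordinate 0 nonzero, so each vector defines a projective point.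
  obtain ⟨y, hy⟩ := exists_eval_ne_zero (mul_ne_zero hF
    (Finset.prod_ne_zero_iff (s := Finset.univ)
      (f := fun i : Fin n => (X (i, 0) : MvPolynomial (Fin n × Fin (N + 1)) K)).mpr
        fun i _ => X_ne_zero (i, 0)))
  rw [map_mul, mul_ne_zero_iff, map_prod, Finset.prod_ne_zero_iff] at hy
  refine ⟨fun i j => y (i, j), fun i h => hy.2 i (Finset.mem_univ i) ?_, hy.1⟩
  rw [eval_X]
  exact congrFun h 0

theorem ForGeneralPoints.exists_of_and {P Q : (Fin n → ProjPoint K N) → Prop}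
    (hP : ForGeneralPoints K N n P) (hQ : ForGeneralPoints K N n Q) : ∃ p, P p ∧ Q p := by
  obtain ⟨F, hF0, hF⟩ := hP
  obtain ⟨G, hG0, hG⟩ := hQ
  obtain ⟨v, hv, hFG⟩ := exists_general_of_ne_zero (mul_ne_zero hF0 hG0)
  rw [map_mul, mul_ne_zero_iff] at hFG
  exact ⟨fun i => Projectivization.mk K (v i) (hv i), hF _ ⟨v, hv, fun _ => rfl, hFG.1⟩,
    hG _ ⟨v, hv, fun _ => rfl, hFG.2⟩⟩

variable (K n) in
theorem forGeneralPoints_alpha_eq_maxLeastDegree (hN : N ≠ 0) (m : ℕ) :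
    ForGeneralPoints K N n fun p =>
      alpha (symbolicPower (pointsIdeal p) m) = maxLeastDegree K (Fin (N + 1)) n m := by
  have : Nontrivial (Fin (N + 1)) := Fin.nontrivial_iff_two_le.mpr (by omega)
  obtain ⟨F, hF0, hF⟩ := exists_open_leastDegree_eq K (Fin (N + 1)) n m
  refine ⟨F, hF0, ?_⟩
  rintro p ⟨v, hv, hp, hFv⟩
  rw [alpha_symbolicPower_eq_leastDegree hv hp, hF v hFv]

variable (K n) in
-- Two nonempty open conditions have a common point, so there is only one general value.
theorem genericAlpha_eq_maxLeastDegree (hN : N ≠ 0) (m : ℕ) :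
    genericAlpha K N n m = maxLeastDegree K (Fin (N + 1)) n m := by
  have h := forGeneralPoints_alpha_eq_maxLeastDegree K n hN m
  have hmem : genericAlpha K N n m ∈ {a : ℕ | ForGeneralPoints K N n fun p =>
      alpha (symbolicPower (pointsIdeal p) m) = a} := Nat.sInf_mem ⟨_, h⟩
  obtain ⟨p, hp₁, hp₂⟩ := ForGeneralPoints.exists_of_and hmem h
  exact hp₁.symm.trans hp₂

variable (K n) in
theorem forGeneralPoints_alpha_eq_genericAlpha (hN : N ≠ 0) (m : ℕ) :
    ForGeneralPoints K N n fun p =>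
      alpha (symbolicPower (pointsIdeal p) m) = genericAlpha K N n m := by
  rw [genericAlpha_eq_maxLeastDegree K n hN]
  exact forGeneralPoints_alpha_eq_maxLeastDegree K n hN m

variable (K n) in
theorem tendsto_genericAlpha_div (hN : N ≠ 0) :
    Tendsto (fun m : ℕ => (genericAlpha K N n m : ℝ) / m) atTop (𝓝 (gamma K N n)) := by
  have : Nontrivial (Fin (N + 1)) := Fin.nontrivial_iff_two_le.mpr (by omega)
  have hsub : Subadditive fun m : ℕ => (genericAlpha K N n m : ℝ) := by
    intro a b
    simp only [genericAlpha_eq_maxLeastDegree K n hN]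
    exact_mod_cast maxLeastDegree_add_le K (Fin (N + 1)) n a b
  have hbdd : BddBelow (Set.range fun m : ℕ => (genericAlpha K N n m : ℝ) / m) := by
    refine ⟨0, ?_⟩
    rintro _ ⟨m, rfl⟩
    positivity
  exact tendsto_nhds_limUnder ⟨_, hsub.tendsto_lim hbdd⟩

variable (K n) in
theorem forVeryGeneralPoints_hasWaldschmidtConstant (hN : N ≠ 0) :
    ForVeryGeneralPoints K N n fun p =>
      HasWaldschmidtConstant (pointsIdeal p) (gamma K N n) := by
  choose F hF0 hF using forGeneralPoints_alpha_eq_genericAlpha K n hN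
  refine ⟨F, hF0, fun p hp => ?_⟩
  unfold HasWaldschmidtConstant
  simp_rw [fun m => hF m p (hp m)]
  exact tendsto_genericAlpha_div K n hN

variable (K) in
theorem gamma_mono (hN : N ≠ 0) {k n : ℕ} (h : k ≤ n) : gamma K N k ≤ gamma K N n := by
  have : Nontrivial (Fin (N + 1)) := Fin.nontrivial_iff_two_le.mpr (by omega)
  refine le_of_tendsto_of_tendsto' (tendsto_genericAlpha_div K k hN)
    (tendsto_genericAlpha_div K n hN) fun m => ?_
  rw [genericAlpha_eq_maxLeastDegree K k hN, genericAlpha_eq_maxLeastDegree K n hN]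
  gcongr
  exact maxLeastDegree_mono K (Fin (N + 1)) h m

end GeneralPoints

/-! ### Multiplying the number of points by eight -/

theorem two_mul_gamma_le (K : Type*) [Field K] [CharZero K] (a : ℕ) :
    2 * gamma K 3 a ≤ gamma K 3 (a * 8) := by
  have h8 : Tendsto (fun m : ℕ => 8 * m) atTop atTop :=
    tendsto_id.const_mul_atTop' (by norm_num)
  -- The limit `γ(a)` is taken along the multiples `8 * m`, where the comparison of degrees applies.
  have h1 := ((tendsto_genericAlpha_div K a three_ne_zero).comp h8).const_mul 2
  refine le_of_tendsto_of_tendsto' h1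
    (tendsto_genericAlpha_div K (a * 8) three_ne_zero) fun m => ?_
  have h2 := maxLeastDegree_eight_mul_le K a m
  rw [← genericAlpha_eq_maxLeastDegree K a three_ne_zero,
    ← genericAlpha_eq_maxLeastDegree K (a * 8) three_ne_zero] at h2
  have h3 : (genericAlpha K 3 a (8 * m) : ℝ) ≤ 4 * genericAlpha K 3 (a * 8) m := by
    exact_mod_cast h2
  rcases Nat.eq_zero_or_pos m with rfl | hm
  · simp
  · have hm' : (0 : ℝ) < m := by exact_mod_cast hm
    simp only [Function.comp_apply, Nat.cast_mul, Nat.cast_ofNat]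
    rw [le_div_iff₀ hm']
    have : 2 * ((genericAlpha K 3 a (8 * m) : ℝ) / (8 * m)) * m =
        genericAlpha K 3 a (8 * m) / 4 := by
      field_simp
      ring
    rw [this]
    linarith

theorem two_pow_mul_gamma_le (K : Type*) [Field K] [CharZero K] (a k : ℕ) :
    2 ^ k * gamma K 3 a ≤ gamma K 3 (a * 8 ^ k) := by
  induction k with
  | zero => simp
  | succ k ih =>
    rw [pow_succ 8, ← mul_assoc a]
    refine le_trans ?_ (two_mul_gamma_le K (a * 8 ^ k))
    rw [pow_succ, mul_comm (2 ^ k), mul_assoc]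
    gcongr

end GenericPoints

/-- The first three clauses say that `γ(n) = γ(3, n)` is well defined: `α(I^(m))` has a general
value for every `m`, the limit of these values divided by `m` exists, and it is the Waldschmidt
constant of the ideal of `n` points in very general position. -/
theorem proposition2p5 (K : Type*) [Field K] [CharZero K] :
    (∀ n m : ℕ, GenericPoints.ForGeneralPoints K 3 n fun p =>
      GenericPoints.alpha (GenericPoints.symbolicPower (GenericPoints.pointsIdeal p) m) =
        GenericPoints.genericAlpha K 3 n m) ∧
    (∀ n : ℕ, Tendsto (fun m : ℕ => (GenericPoints.genericAlpha K 3 n m : ℝ) / m) atTop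
      (𝓝 (GenericPoints.gamma K 3 n))) ∧
    (∀ n : ℕ, GenericPoints.ForVeryGeneralPoints K 3 n fun p =>
      GenericPoints.HasWaldschmidtConstant (GenericPoints.pointsIdeal p)
        (GenericPoints.gamma K 3 n)) ∧
    (∀ n k : ℕ, k ≤ n → GenericPoints.gamma K 3 k ≤ GenericPoints.gamma K 3 n) ∧
    (∀ a k : ℕ, 2 ^ k * GenericPoints.gamma K 3 a ≤ GenericPoints.gamma K 3 (a * 8 ^ k)) :=
  ⟨fun n m => GenericPoints.forGeneralPoints_alpha_eq_genericAlpha K n three_ne_zero m,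
    fun n => GenericPoints.tendsto_genericAlpha_div K n three_ne_zero,
    fun n => GenericPoints.forVeryGeneralPoints_hasWaldschmidtConstant K n three_ne_zero,
    fun _ _ h => GenericPoints.gamma_mono K three_ne_zero h,
    GenericPoints.two_pow_mul_gamma_le K⟩
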